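/- Let $(A_0,A_1)$ be a compatible couple of Banach spaces over $\mathbb R$ or $\mathbb C$, i.e. $A_0$ and $A_1$ are continuously embedded in a common Hausdorff topological vector space $Z$. For $t>0$ and $f\in A_0+A_1$ let $$K(t,f)=\inf\{\|f_0\|_{A_0}+t\|f_1\|_{A_1} : f=f_0+f_1,\ f_0\in A_0,\ f_1\in A_1\}.$$ Let $0<\theta<1$, and let $q:\mathbb R\to[1,\infty)$ be measurable and log-Hölder continuous at the origin and at infinity: there are constants $c>0$ and $q_\infty\in\mathbb R$ with $$|q(x)-q(0)|\le\frac{c}{\log(e+1/|x|)}\quad(x\ne 0),\qquad |q(x)-q_\infty|\le\frac{c}{\log(e+|x|)}\quad(x\in\mathbb R).$$ Let $(A_0,A_1)_{\theta,q(\cdot)}$ be the space of all $f\in A_0+A_1$ for which $$\|f\|_{\theta,q(\cdot)}=\inf\Big\{\lambda>0:\int_0^\infty\Big(\frac{t^{-\theta}K(t,f)}{\lambda}\Big)^{q(t)}\frac{dt}{t}\le 1\Big\}$$ is finite (with $\inf\emptyset=\infty$). Then $A_0\cap A_1$ is dense in $(A_0,A_1)_{\theta,q(\cdot)}$: one has $A_0\cap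 A_1\subseteq(A_0,A_1)_{\theta,q(\cdot)}$, and for every $f\in(A_0,A_1)_{\theta,q(\cdot)}$ and every $\varepsilon>0$ there is $g\in A_0\cap A_1$ with $\|f-g\|_{\theta,q(\cdot)}<\varepsilon$. -/

import Mathlib

open MeasureTheory Set
open scoped ENNReal

noncomputable section

namespace VarInterp

/-- The class `𝒫(ℝ)` of variable exponents: (Lebesgue) measurable functions on `ℝ` with range in
`[1, ∞)`. -/
structure IsVariableExponent (q : ℝ → ℝ) : Prop where
  aemeasurable : AEMeasurable q volume
  one_le : ∀ x, 1 ≤ q x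

/-- Log-Hölder continuity at the origin:
`|g(x) - g(0)| ≤ c / log(e + 1/|x|)` (at `x = 0` the left side vanishes, so nothing is asked). -/
def LogHolderAtOrigin (g : ℝ → ℝ) : Prop :=
  ∃ c : ℝ, 0 < c ∧ ∀ x : ℝ, |g x - g 0| ≤ c / Real.log (Real.exp 1 + 1 / |x|)

/-- Log-Hölder continuity at infinity (the log-Hölder decay condition):
`|g(x) - g_∞| ≤ c / log(e + |x|)` for some real number `g_∞`. -/
def LogHolderAtInfinity (g : ℝ → ℝ) : Prop :=
  ∃ gInf : ℝ, ∃ c : ℝ, 0 < c ∧ ∀ x : ℝ, |g x - gInf| ≤ c / Real.log (Real.exp 1 + |x|)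

/-- The modular `∫ |f(t)|^{q(t)} dμ(t)` of the variable exponent Lebesgue space over `μ`. -/
def modular (μ : Measure ℝ) (q f : ℝ → ℝ) : ℝ≥0∞ :=
  ∫⁻ t, ‖f t‖ₑ ^ q t ∂μ

/-- The Luxemburg norm `inf {r > 0 : modular (f / r) ≤ 1}`, with value `∞` if there is no such
`r`. -/
def luxemburgNorm (μ : Measure ℝ) (q f : ℝ → ℝ) : ℝ≥0∞ :=
  ⨅ (r : ℝ) (_ : 0 < r) (_ : modular μ q (fun t => f t / r) ≤ 1), ENNReal.ofReal r

/-- The measure `dt/t` on `(0, ∞)`. -/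
def dtOverT : Measure ℝ :=
  (volume.restrict (Ioi 0)).withDensity fun t => ENNReal.ofReal t⁻¹

/-- A compatible couple: `A₀` and `A₁` are continuously and injectively embedded by linear maps
in a common topological vector space `Z` (which is Hausdorff in the theorem). -/
structure CompatibleCouple (𝕜 A₀ A₁ Z : Type*) [RCLike 𝕜]
    [NormedAddCommGroup A₀] [NormedSpace 𝕜 A₀] [NormedAddCommGroup A₁] [NormedSpace 𝕜 A₁]
    [AddCommGroup Z] [Module 𝕜 Z] [TopologicalSpace Z] where
  emb₀ : A₀ →L[𝕜] Z
  emb₁ : A₁ →L[𝕜] Z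
  injective₀ : Function.Injective emb₀
  injective₁ : Function.Injective emb₁

namespace CompatibleCouple

variable {𝕜 A₀ A₁ Z : Type*} [RCLike 𝕜]
  [NormedAddCommGroup A₀] [NormedSpace 𝕜 A₀] [NormedAddCommGroup A₁] [NormedSpace 𝕜 A₁]
  [AddCommGroup Z] [Module 𝕜 Z] [TopologicalSpace Z]

/-- `A₀ + A₁` as a subspace of `Z`. -/
def sum (C : CompatibleCouple 𝕜 A₀ A₁ Z) : Submodule 𝕜 Z :=
  LinearMap.range (C.emb₀ : A₀ →ₗ[𝕜] Z) ⊔ LinearMap.range (C.emb₁ : A₁ →ₗ[𝕜] Z)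

/-- `A₀ ∩ A₁` as a subspace of `Z`. -/
def inter (C : CompatibleCouple 𝕜 A₀ A₁ Z) : Submodule 𝕜 Z :=
  LinearMap.range (C.emb₀ : A₀ →ₗ[𝕜] Z) ⊓ LinearMap.range (C.emb₁ : A₁ →ₗ[𝕜] Z)

/-- The `K`-functional `K(t, f) = inf {‖f₀‖ + t ‖f₁‖ : f = f₀ + f₁}`, used for `t > 0` and
`f ∈ A₀ + A₁`. -/
def K (C : CompatibleCouple 𝕜 A₀ A₁ Z) (t : ℝ) (f : Z) : ℝ :=
  sInf {r : ℝ | ∃ (f₀ : A₀) (f₁ : A₁), C.emb₀ f₀ + C.emb₁ f₁ = f ∧ r = ‖f₀‖ + t * ‖f₁‖}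

/-- The functional `‖f‖_{θ,q(·)} = ‖t^{-θ} K(t, f)‖` in `L^{q(·)}((0,∞), dt/t)`, used for
`f ∈ A₀ + A₁`. -/
def interpNorm (C : CompatibleCouple 𝕜 A₀ A₁ Z) (θ : ℝ) (q : ℝ → ℝ) (f : Z) : ℝ≥0∞ :=
  luxemburgNorm dtOverT q fun t => t ^ (-θ) * C.K t f

/-- The space `(A₀, A₁)_{θ,q(·)}`. -/
def interpSpace (C : CompatibleCouple 𝕜 A₀ A₁ Z) (θ : ℝ) (q : ℝ → ℝ) : Set Z :=
  {f | f ∈ C.sum ∧ C.interpNorm θ q f < ∞}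

end CompatibleCouple

end VarInterp

end

namespace VarInterp

lemma LogHolderAtOrigin.exists_le {q : ℝ → ℝ} (h : LogHolderAtOrigin q) : ∃ Q : ℝ, ∀ x, q x ≤ Q := by
  obtain ⟨c, hc, h⟩ := h
  refine ⟨q 0 + c, fun x => ?_⟩
  have h1 : 1 ≤ Real.log (Real.exp 1 + 1 / |x|) := by
    rw [Real.le_log_iff_exp_le (by positivity)]
    have : 0 ≤ 1 / |x| := by positivity
    linarith
  have h2 := (le_abs_self _).trans (h x)
  have h3 : c / Real.log (Real.exp 1 + 1 / |x|) ≤ c := div_le_self hc.le h1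
  linarith

lemma setLIntegral_dtOverT {s : Set ℝ} (hs : MeasurableSet s) (hs0 : s ⊆ Ioi 0) (F : ℝ → ℝ≥0∞) :
    ∫⁻ t in s, F t ∂dtOverT = ∫⁻ t in s, ENNReal.ofReal t⁻¹ * F t := by
  rw [dtOverT, setLIntegral_withDensity_eq_setLIntegral_mul_non_measurable _ (by fun_prop) _ hs
    (by simp), Measure.restrict_restrict hs, inter_eq_self_of_subset_left hs0]
  rfl

lemma dtOverT_compl_Ioi : dtOverT (Ioi 0)ᶜ = 0 := by
  rw [dtOverT, withDensity_apply _ measurableSet_Ioi.compl,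
    Measure.restrict_restrict measurableSet_Ioi.compl, compl_inter_self, setLIntegral_empty]

lemma setLIntegral_Ioc_rpow_le {s b : ℝ} (hs : 0 < s) (hb : 0 < b) :
    ∫⁻ t in Ioc 0 b, ENNReal.ofReal ((t / b) ^ s) ∂dtOverT ≤ ENNReal.ofReal (1 / s) := by
  rw [setLIntegral_dtOverT measurableSet_Ioc Ioc_subset_Ioi_self]
  have hint : IntegrableOn (fun t : ℝ => t ^ (s - 1)) (Ioc 0 b) := by
    rw [← intervalIntegrable_iff_integrableOn_Ioc_of_le hb.le]
    exact intervalIntegral.intervalIntegrable_rpow' (by linarith)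
  have heq : ∫⁻ t in Ioc 0 b, ENNReal.ofReal t⁻¹ * ENNReal.ofReal ((t / b) ^ s) =
      ∫⁻ t in Ioc 0 b, ENNReal.ofReal (b ^ (-s) * t ^ (s - 1)) := by
    refine setLIntegral_congr_fun measurableSet_Ioc fun t ht => ?_
    have ht0 : 0 < t := ht.1
    rw [← ENNReal.ofReal_mul (by positivity), Real.div_rpow ht0.le hb.le, Real.rpow_neg hb.le,
      Real.rpow_sub_one ht0.ne']
    congr 1
    field_simp
  rw [heq, ← ofReal_integral_eq_lintegral_ofReal (hint.const_mul _)
    ((ae_restrict_iff' measurableSet_Ioc).2 (.of_forall fun t ht => by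
      have : 0 < t := ht.1
      positivity)),
    integral_const_mul, ← intervalIntegral.integral_of_le hb.le,
    integral_rpow (Or.inl (by linarith))]
  refine ENNReal.ofReal_le_ofReal (le_of_eq ?_)
  rw [sub_add_cancel, Real.zero_rpow hs.ne', Real.rpow_neg hb.le]
  have : b ^ s ≠ 0 := by positivity
  field_simp
  ring

lemma setLIntegral_Ioi_rpow_le {s a : ℝ} (hs : 0 < s) (ha : 0 < a) :
    ∫⁻ t in Ioi a, ENNReal.ofReal ((t / a) ^ (-s)) ∂dtOverT ≤ ENNReal.ofReal (1 / s) := by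
  rw [setLIntegral_dtOverT measurableSet_Ioi (Ioi_subset_Ioi ha.le)]
  have hint : IntegrableOn (fun t : ℝ => t ^ (-s - 1)) (Ioi a) :=
    integrableOn_Ioi_rpow_of_lt (by linarith) ha
  have heq : ∫⁻ t in Ioi a, ENNReal.ofReal t⁻¹ * ENNReal.ofReal ((t / a) ^ (-s)) =
      ∫⁻ t in Ioi a, ENNReal.ofReal (a ^ s * t ^ (-s - 1)) := by
    refine setLIntegral_congr_fun measurableSet_Ioi fun t ht => ?_
    have ht0 : 0 < t := ha.trans ht
    rw [← ENNReal.ofReal_mul (by positivity), Real.div_rpow ht0.le ha.le, Real.rpow_neg ha.le,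
      Real.rpow_sub_one ht0.ne']
    congr 1
    field_simp
  rw [heq, ← ofReal_integral_eq_lintegral_ofReal (hint.const_mul _)
    ((ae_restrict_iff' measurableSet_Ioi).2 (.of_forall fun t ht => by
      have : 0 < t := ha.trans ht
      positivity)),
    integral_const_mul, integral_Ioi_rpow_of_lt (by linarith) ha]
  refine ENNReal.ofReal_le_ofReal (le_of_eq ?_)
  rw [sub_add_cancel, Real.rpow_neg ha.le]
  have : a ^ s ≠ 0 := by positivity
  field_simp

lemma dtOverT_Ioo_eq_top {a : ℝ} (ha : 0 < a) : dtOverT (Ioo 0 a) = ∞ := by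
  by_contra hfin
  rw [← setLIntegral_one, setLIntegral_dtOverT measurableSet_Ioo Ioo_subset_Ioi_self] at hfin
  simp only [mul_one] at hfin
  have hint : IntegrableOn (fun t : ℝ => t⁻¹) (Ioo 0 a) := by
    refine (lintegral_ofReal_ne_top_iff_integrable (by fun_prop)
      ((ae_restrict_iff' measurableSet_Ioo).2 (.of_forall fun t ht => ?_))).1 hfin
    exact inv_nonneg.2 ht.1.le
  rw [← integrableOn_Ioc_iff_integrableOn_Ioo,
    ← intervalIntegrable_iff_integrableOn_Ioc_of_le ha.le, intervalIntegrable_inv_iff] at hint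
  rcases hint with h | h
  · exact ha.ne h
  · exact h left_mem_uIcc

lemma dtOverT_Ioi_eq_top {b : ℝ} (hb : 0 < b) : dtOverT (Ioi b) = ∞ := by
  by_contra hfin
  rw [← setLIntegral_one, setLIntegral_dtOverT measurableSet_Ioi (Ioi_subset_Ioi hb.le)] at hfin
  simp only [mul_one] at hfin
  refine not_integrableOn_Ioi_inv (a := b)
    ((lintegral_ofReal_ne_top_iff_integrable (by fun_prop)
      ((ae_restrict_iff' measurableSet_Ioi).2 (.of_forall fun t ht => ?_))).1 hfin)
  exact inv_nonneg.2 (hb.trans ht).le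

/-- On a set of infinite measure a function with finite modular takes arbitrarily small values. -/
lemma exists_lt_of_modular_ne_top {μ : Measure ℝ} {q f : ℝ → ℝ} {Q : ℝ} (hQ : ∀ x, q x ≤ Q)
    (hq : ∀ x, 1 ≤ q x) (hf : modular μ q f ≠ ∞) {s : Set ℝ} (hs : MeasurableSet s)
    (hμ : μ s = ∞) {η : ℝ} (hη : 0 < η) : ∃ t ∈ s, |f t| < η := by
  by_contra! hcon
  set d : ℝ := min η 1
  have hd : 0 < d := lt_min hη one_pos
  refine hf (top_unique ?_)
  calc ∞ = ENNReal.ofReal d ^ Q * μ s := by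
        rw [hμ, ENNReal.mul_top]
        exact (ENNReal.rpow_pos (ENNReal.ofReal_pos.2 hd) ENNReal.ofReal_ne_top).ne'
    _ = ∫⁻ _ in s, ENNReal.ofReal d ^ Q ∂μ := (setLIntegral_const _ _).symm
    _ ≤ ∫⁻ t in s, ‖f t‖ₑ ^ q t ∂μ := by
        refine setLIntegral_mono' hs fun t ht => ?_
        calc ENNReal.ofReal d ^ Q ≤ ENNReal.ofReal d ^ q t :=
              ENNReal.rpow_le_rpow_of_exponent_ge
                (ENNReal.ofReal_le_one.2 (min_le_right _ _)) (hQ t)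
          _ ≤ ‖f t‖ₑ ^ q t := by
              refine ENNReal.rpow_le_rpow ?_ (by linarith [hq t])
              rw [Real.enorm_eq_ofReal_abs]
              exact ENNReal.ofReal_le_ofReal ((min_le_left _ _).trans (hcon t ht))
    _ ≤ modular μ q f := setLIntegral_le_lintegral _ _

lemma modular_const_mul_ne_top {μ : Measure ℝ} {q f : ℝ → ℝ} {Q : ℝ} (hQ : ∀ x, q x ≤ Q)
    (hq : ∀ x, 1 ≤ q x) (hf : modular μ q f ≠ ∞) (c : ℝ) :
    modular μ q (fun t => c * f t) ≠ ∞ := by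
  have hQ0 : 0 ≤ Q := by linarith [hq 0, hQ 0]
  set C : ℝ≥0∞ := max 1 ‖c‖ₑ with hC
  have hCt : C ^ Q ≠ ∞ := ENNReal.rpow_ne_top_of_nonneg hQ0 (by simp [hC])
  refine ne_top_of_le_ne_top (ENNReal.mul_ne_top hCt hf) ?_
  rw [modular, modular, ← lintegral_const_mul' _ _ hCt]
  refine lintegral_mono fun t => ?_
  have hq0 : 0 ≤ q t := by linarith [hq t]
  simp only
  rw [enorm_mul, ENNReal.mul_rpow_of_nonneg _ _ hq0]
  gcongr
  exact (ENNReal.rpow_le_rpow (le_max_right 1 _) hq0).trans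
    (ENNReal.rpow_le_rpow_of_exponent_le (le_max_left 1 _) (hQ t))

lemma exists_setLIntegral_Ioc_le {μ : Measure ℝ} {F : ℝ → ℝ≥0∞} (hF : ∫⁻ t, F t ∂μ ≠ ∞)
    {δ : ℝ≥0∞} (hδ : 0 < δ) : ∃ a : ℝ, 0 < a ∧ a ≤ 1 ∧ ∫⁻ t in Ioc 0 a, F t ∂μ ≤ δ := by
  have : IsFiniteMeasure (μ.withDensity F) := isFiniteMeasure_withDensity hF
  have hlim := tendsto_measure_iInter_atTop (μ := μ.withDensity F)
    (s := fun n : ℕ => Ioc (0 : ℝ) (1 / (n + 1)))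
    (fun n => measurableSet_Ioc.nullMeasurableSet)
    (fun m n hmn => Ioc_subset_Ioc_right (Nat.one_div_le_one_div hmn))
    ⟨0, measure_ne_top _ _⟩
  have hemp : ⋂ n : ℕ, Ioc (0 : ℝ) (1 / (n + 1)) = ∅ := by
    refine eq_empty_of_forall_notMem fun x hx => ?_
    rw [mem_iInter] at hx
    obtain ⟨n, hn⟩ := exists_nat_one_div_lt (hx 0).1
    exact absurd (hx n).2 (not_le.2 hn)
  rw [hemp, measure_empty] at hlim
  obtain ⟨n, hn⟩ := (hlim.eventually (gt_mem_nhds hδ)).exists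
  refine ⟨1 / (n + 1), by positivity, ?_, ?_⟩
  · rw [div_le_one (by positivity)]
    linarith [(Nat.cast_nonneg n : (0 : ℝ) ≤ n)]
  · rw [← withDensity_apply _ measurableSet_Ioc]
    exact hn.le

lemma exists_setLIntegral_Ici_le {μ : Measure ℝ} {F : ℝ → ℝ≥0∞} (hF : ∫⁻ t, F t ∂μ ≠ ∞)
    {δ : ℝ≥0∞} (hδ : 0 < δ) : ∃ b : ℝ, 1 ≤ b ∧ ∫⁻ t in Ici b, F t ∂μ ≤ δ := by
  have : IsFiniteMeasure (μ.withDensity F) := isFiniteMeasure_withDensity hF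
  have hlim := tendsto_measure_iInter_atTop (μ := μ.withDensity F)
    (s := fun n : ℕ => Ici ((n : ℝ) + 1))
    (fun n => measurableSet_Ici.nullMeasurableSet)
    (fun m n hmn => Ici_subset_Ici.2 (by gcongr))
    ⟨0, measure_ne_top _ _⟩
  have hemp : ⋂ n : ℕ, Ici ((n : ℝ) + 1) = ∅ := by
    refine eq_empty_of_forall_notMem fun x hx => ?_
    rw [mem_iInter] at hx
    obtain ⟨n, hn⟩ := exists_nat_gt x
    have := hx n
    rw [mem_Ici] at this
    linarith
  rw [hemp, measure_empty] at hlim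
  obtain ⟨n, hn⟩ := (hlim.eventually (gt_mem_nhds hδ)).exists
  refine ⟨n + 1, by linarith [(Nat.cast_nonneg n : (0 : ℝ) ≤ n)], ?_⟩
  rw [← withDensity_apply _ measurableSet_Ici]
  exact hn.le

lemma enorm_rpow_le_ofReal {x y p : ℝ} (hx : 0 ≤ x) (hxy : x ≤ y) (hy : y ≤ 1) (hp : 1 ≤ p) :
    ‖x‖ₑ ^ p ≤ ENNReal.ofReal y := by
  rw [Real.enorm_eq_ofReal hx]
  calc ENNReal.ofReal x ^ p ≤ ENNReal.ofReal x ^ (1 : ℝ) :=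
        ENNReal.rpow_le_rpow_of_exponent_ge (ENNReal.ofReal_le_one.2 (hxy.trans hy)) hp
    _ ≤ ENNReal.ofReal y := by
        rw [ENNReal.rpow_one]
        exact ENNReal.ofReal_le_ofReal hxy

lemma setLIntegral_Ioi_rpow_exponent_le {q h : ℝ → ℝ} (hq : ∀ x, 1 ≤ q x) {s a α : ℝ}
    (hs : 0 < s) (ha : 0 < a) (hα : 0 ≤ α) (hα1 : α ≤ 1)
    (h0 : ∀ t, a < t → 0 ≤ h t) (hh : ∀ t, a < t → h t ≤ α * (t / a) ^ (-s)) :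
    ∫⁻ t in Ioi a, ‖h t‖ₑ ^ q t ∂dtOverT ≤ ENNReal.ofReal (α / s) := by
  calc ∫⁻ t in Ioi a, ‖h t‖ₑ ^ q t ∂dtOverT
      ≤ ∫⁻ t in Ioi a, ENNReal.ofReal α * ENNReal.ofReal ((t / a) ^ (-s)) ∂dtOverT := by
        refine setLIntegral_mono' measurableSet_Ioi fun t ht => ?_
        rw [← ENNReal.ofReal_mul hα]
        have : (t / a) ^ (-s) ≤ 1 :=
          Real.rpow_le_one_of_one_le_of_nonpos ((one_le_div ha).2 (le_of_lt ht)) (by linarith)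
        exact enorm_rpow_le_ofReal (h0 t ht) (hh t ht) (mul_le_one₀ hα1
          (Real.rpow_nonneg (div_nonneg (ha.trans ht).le ha.le) _) this) (hq t)
    _ ≤ ENNReal.ofReal α * ENNReal.ofReal (1 / s) := by
        rw [lintegral_const_mul' _ _ ENNReal.ofReal_ne_top]
        gcongr
        exact setLIntegral_Ioi_rpow_le hs ha
    _ = ENNReal.ofReal (α / s) := by
        rw [← ENNReal.ofReal_mul hα, mul_one_div]

lemma setLIntegral_Ioc_rpow_exponent_le {q h : ℝ → ℝ} (hq : ∀ x, 1 ≤ q x) {s b β : ℝ}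
    (hs : 0 < s) (hb : 0 < b) (hβ : 0 ≤ β) (hβ1 : β ≤ 1)
    (h0 : ∀ t, 0 < t → t ≤ b → 0 ≤ h t) (hh : ∀ t, 0 < t → t ≤ b → h t ≤ β * (t / b) ^ s) :
    ∫⁻ t in Ioc 0 b, ‖h t‖ₑ ^ q t ∂dtOverT ≤ ENNReal.ofReal (β / s) := by
  calc ∫⁻ t in Ioc 0 b, ‖h t‖ₑ ^ q t ∂dtOverT
      ≤ ∫⁻ t in Ioc 0 b, ENNReal.ofReal β * ENNReal.ofReal ((t / b) ^ s) ∂dtOverT := by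
        refine setLIntegral_mono' measurableSet_Ioc fun t ht => ?_
        rw [← ENNReal.ofReal_mul hβ]
        have h1 : 0 ≤ t / b := div_nonneg ht.1.le hb.le
        have : (t / b) ^ s ≤ 1 := Real.rpow_le_one h1 ((div_le_one hb).2 ht.2) hs.le
        exact enorm_rpow_le_ofReal (h0 t ht.1 ht.2) (hh t ht.1 ht.2) (mul_le_one₀ hβ1
          (Real.rpow_nonneg h1 _) this) (hq t)
    _ ≤ ENNReal.ofReal β * ENNReal.ofReal (1 / s) := by
        rw [lintegral_const_mul' _ _ ENNReal.ofReal_ne_top]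
        gcongr
        exact setLIntegral_Ioc_rpow_le hs hb
    _ = ENNReal.ofReal (β / s) := by
        rw [← ENNReal.ofReal_mul hβ, mul_one_div]

lemma setLIntegral_Ioo_rpow_exponent_le {q h : ℝ → ℝ} (hq : ∀ x, 1 ≤ q x) {s r a b α β : ℝ}
    (hs : 0 < s) (hr : 0 < r) (ha : 0 < a) (hb : 0 < b) (hα : 0 ≤ α) (hα1 : α ≤ 1 / 2)
    (hβ : 0 ≤ β) (hβ1 : β ≤ 1 / 2) (h0 : ∀ t ∈ Ioo a b, 0 ≤ h t)
    (hh : ∀ t ∈ Ioo a b, h t ≤ α * (t / a) ^ (-s) + β * (t / b) ^ r) :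
    ∫⁻ t in Ioo a b, ‖h t‖ₑ ^ q t ∂dtOverT ≤
      ENNReal.ofReal (α / s) + ENNReal.ofReal (β / r) := by
  calc ∫⁻ t in Ioo a b, ‖h t‖ₑ ^ q t ∂dtOverT
      ≤ ∫⁻ t in Ioo a b, (ENNReal.ofReal α * ENNReal.ofReal ((t / a) ^ (-s)) +
          ENNReal.ofReal β * ENNReal.ofReal ((t / b) ^ r)) ∂dtOverT := by
        refine setLIntegral_mono' measurableSet_Ioo fun t ht => ?_
        have ht0 : 0 < t := ha.trans ht.1
        rw [← ENNReal.ofReal_mul hα, ← ENNReal.ofReal_mul hβ,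
          ← ENNReal.ofReal_add (by positivity) (by positivity)]
        have h1 : (t / a) ^ (-s) ≤ 1 :=
          Real.rpow_le_one_of_one_le_of_nonpos ((one_le_div ha).2 ht.1.le) (by linarith)
        have h2 : (t / b) ^ r ≤ 1 :=
          Real.rpow_le_one (by positivity) ((div_le_one hb).2 ht.2.le) hr.le
        refine enorm_rpow_le_ofReal (h0 t ht) (hh t ht) ?_ (hq t)
        nlinarith
    _ = ENNReal.ofReal α * ∫⁻ t in Ioo a b, ENNReal.ofReal ((t / a) ^ (-s)) ∂dtOverT +
          ENNReal.ofReal β * ∫⁻ t in Ioo a b, ENNReal.ofReal ((t / b) ^ r) ∂dtOverT := by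
        rw [lintegral_add_left (by fun_prop), lintegral_const_mul' _ _ ENNReal.ofReal_ne_top,
          lintegral_const_mul' _ _ ENNReal.ofReal_ne_top]
    _ ≤ ENNReal.ofReal α * ENNReal.ofReal (1 / s) + ENNReal.ofReal β * ENNReal.ofReal (1 / r) := by
        gcongr
        · exact (lintegral_mono_set Ioo_subset_Ioi_self).trans (setLIntegral_Ioi_rpow_le hs ha)
        · refine (lintegral_mono_set fun t ht => ?_).trans (setLIntegral_Ioc_rpow_le hr hb)
          exact ⟨ha.trans ht.1, ht.2.le⟩
    _ = ENNReal.ofReal (α / s) + ENNReal.ofReal (β / r) := by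
        rw [← ENNReal.ofReal_mul hα, ← ENNReal.ofReal_mul hβ, mul_one_div, mul_one_div]

lemma luxemburgNorm_le {μ : Measure ℝ} {q f : ℝ → ℝ} {r : ℝ} (hr : 0 < r)
    (h : modular μ q (fun t => f t / r) ≤ 1) : luxemburgNorm μ q f ≤ ENNReal.ofReal r :=
  iInf_le_of_le r (iInf_le_of_le hr (iInf_le _ h))

lemma exists_modular_le_one {μ : Measure ℝ} {q f : ℝ → ℝ} (h : luxemburgNorm μ q f < ∞) :
    ∃ r : ℝ, 0 < r ∧ modular μ q (fun t => f t / r) ≤ 1 := by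
  simp only [luxemburgNorm, iInf_lt_iff] at h
  obtain ⟨r, hr, hm, -⟩ := h
  exact ⟨r, hr, hm⟩

namespace CompatibleCouple

variable {𝕜 A₀ A₁ Z : Type*} [RCLike 𝕜]
  [NormedAddCommGroup A₀] [NormedSpace 𝕜 A₀] [NormedAddCommGroup A₁] [NormedSpace 𝕜 A₁]
  [AddCommGroup Z] [Module 𝕜 Z] [TopologicalSpace Z] (C : CompatibleCouple 𝕜 A₀ A₁ Z)

lemma exists_of_mem_sum {f : Z} (hf : f ∈ C.sum) : ∃ f₀ f₁, C.emb₀ f₀ + C.emb₁ f₁ = f := by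
  obtain ⟨_, ⟨x, rfl⟩, _, ⟨y, rfl⟩, h⟩ := Submodule.mem_sup.1 hf
  exact ⟨x, y, h⟩

lemma K_nonneg {t : ℝ} (ht : 0 ≤ t) (f : Z) : 0 ≤ C.K t f := by
  refine Real.sInf_nonneg ?_
  rintro r ⟨f₀, f₁, -, rfl⟩
  positivity

lemma K_le {t : ℝ} (ht : 0 ≤ t) {f : Z} {f₀ : A₀} {f₁ : A₁} (h : C.emb₀ f₀ + C.emb₁ f₁ = f) :
    C.K t f ≤ ‖f₀‖ + t * ‖f₁‖ := by
  refine csInf_le ⟨0, ?_⟩ ⟨f₀, f₁, h, rfl⟩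
  rintro r ⟨f₀, f₁, -, rfl⟩
  positivity

lemma exists_lt_of_K_lt {f : Z} (hf : f ∈ C.sum) {t r : ℝ} (h : C.K t f < r) :
    ∃ f₀ f₁, C.emb₀ f₀ + C.emb₁ f₁ = f ∧ ‖f₀‖ + t * ‖f₁‖ < r := by
  obtain ⟨x, y, hxy⟩ := C.exists_of_mem_sum hf
  obtain ⟨_, ⟨f₀, f₁, h1, rfl⟩, h2⟩ := exists_lt_of_csInf_lt (by exact ⟨_, x, y, hxy, rfl⟩) h
  exact ⟨f₀, f₁, h1, h2⟩

lemma K_le_of_forall {f : Z} (hf : f ∈ C.sum) {t r : ℝ}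
    (h : ∀ f₀ f₁, C.emb₀ f₀ + C.emb₁ f₁ = f → r ≤ ‖f₀‖ + t * ‖f₁‖) : r ≤ C.K t f := by
  by_contra! hlt
  obtain ⟨f₀, f₁, h1, h2⟩ := C.exists_lt_of_K_lt hf hlt
  exact absurd (h f₀ f₁ h1) (not_le.2 h2)

lemma K_mono {f : Z} (hf : f ∈ C.sum) {s t : ℝ} (hs : 0 ≤ s) (hst : s ≤ t) :
    C.K s f ≤ C.K t f :=
  C.K_le_of_forall hf fun f₀ f₁ h => (C.K_le hs h).trans (by gcongr)

lemma mul_K_le_mul_K {f : Z} (hf : f ∈ C.sum) {s t : ℝ} (hs : 0 < s) (hst : s ≤ t) :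
    s * C.K t f ≤ t * C.K s f := by
  have ht : 0 < t := hs.trans_le hst
  rw [← div_le_iff₀' ht]
  refine C.K_le_of_forall hf fun f₀ f₁ h => ?_
  rw [div_le_iff₀' ht]
  have h1 := mul_le_mul_of_nonneg_left (C.K_le ht.le h) hs.le
  nlinarith [mul_le_mul_of_nonneg_right hst (norm_nonneg f₀)]

lemma K_add_le {f g : Z} (hf : f ∈ C.sum) (hg : g ∈ C.sum) {t : ℝ}
    (ht : 0 ≤ t) : C.K t (f + g) ≤ C.K t f + C.K t g := by
  rw [← sub_le_iff_le_add]
  refine C.K_le_of_forall hf fun f₀ f₁ h => ?_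
  rw [sub_le_comm]
  refine C.K_le_of_forall hg fun g₀ g₁ h' => ?_
  have h1 : C.K t (f + g) ≤ ‖f₀ + g₀‖ + t * ‖f₁ + g₁‖ := by
    refine C.K_le ht ?_
    rw [← h, ← h', map_add, map_add]
    abel
  have h2 := mul_le_mul_of_nonneg_left (norm_add_le f₁ g₁) ht
  linarith [norm_add_le f₀ g₀]

lemma emb₀_mem_sum (x : A₀) : C.emb₀ x ∈ C.sum := Submodule.mem_sup_left ⟨x, rfl⟩

lemma emb₁_mem_sum (x : A₁) : C.emb₁ x ∈ C.sum := Submodule.mem_sup_right ⟨x, rfl⟩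

lemma K_emb₀_le {t : ℝ} (ht : 0 ≤ t) (x : A₀) : C.K t (C.emb₀ x) ≤ ‖x‖ := by
  simpa using C.K_le ht (f₀ := x) (f₁ := 0) (by simp)

lemma K_emb₁_le {t : ℝ} (ht : 0 ≤ t) (x : A₁) : C.K t (C.emb₁ x) ≤ t * ‖x‖ := by
  simpa using C.K_le ht (f₀ := 0) (f₁ := x) (by simp)

/-- Cutting off near-optimal decompositions of `f` at `a < b` yields an element of `A₀ ∩ A₁`
whose distance to `f` is controlled by the `K`-functional of `f`. -/
lemma exists_mem_inter_K_sub_le {f : Z} (hf : f ∈ C.sum) {a b : ℝ}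
    (ha : 0 < a) (hab : a < b) :
    ∃ g ∈ C.inter, (∀ t, 0 < t → t ≤ a → C.K t (f - g) ≤ 5 * C.K t f) ∧
      (∀ t, b ≤ t → C.K t (f - g) ≤ 5 * C.K t f) ∧
      ∀ t, 0 < t → C.K t (f - g) ≤ 2 * C.K a f + 2 * (t * C.K b f / b) := by
  have hb : 0 < b := ha.trans hab
  rcases (C.K_nonneg ha.le f).eq_or_lt with h0 | hpos
  · have hz : ∀ t, 0 < t → C.K t f = 0 := by
      intro t ht
      refine le_antisymm ?_ (C.K_nonneg ht.le f)
      rcases le_total t a with h | h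
      · exact (C.K_mono hf ht.le h).trans h0.ge
      · have := C.mul_K_le_mul_K hf ha h
        rw [← h0, mul_zero] at this
        exact nonpos_of_mul_nonpos_right this ha
    refine ⟨0, zero_mem _, fun t ht _ => ?_, fun t ht => ?_, fun t ht => ?_⟩
    · simp [hz t ht]
    · simp [hz t (hb.trans_le ht)]
    · simp [hz t ht, hz a ha, hz b hb]
  have hposb : 0 < C.K b f := hpos.trans_le (C.K_mono hf ha.le hab.le)
  obtain ⟨x₀, x₁, hx, hxa⟩ := C.exists_lt_of_K_lt hf (t := a) (r := 2 * C.K a f) (by linarith)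
  obtain ⟨y₀, y₁, hy, hyb⟩ := C.exists_lt_of_K_lt hf (t := b) (r := 2 * C.K b f) (by linarith)
  have hx₀ : ‖x₀‖ ≤ 2 * C.K a f := by nlinarith [norm_nonneg x₁]
  have hx₁ : a * ‖x₁‖ ≤ 2 * C.K a f := by linarith [norm_nonneg x₀]
  have hy₀ : ‖y₀‖ ≤ 2 * C.K b f := by nlinarith [norm_nonneg y₁]
  have hy₁ : b * ‖y₁‖ ≤ 2 * C.K b f := by linarith [norm_nonneg y₀]
  have hy₁' : ∀ t, 0 < t → t * ‖y₁‖ ≤ 2 * (t * C.K b f / b) := by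
    intro t ht
    have : ‖y₁‖ ≤ 2 * C.K b f / b := by rwa [le_div_iff₀' hb]
    calc t * ‖y₁‖ ≤ t * (2 * C.K b f / b) := by gcongr
      _ = _ := by ring
  have hsub : f - C.emb₀ (y₀ - x₀) = C.emb₀ x₀ + C.emb₁ y₁ := by
    rw [← hy, map_sub]
    abel
  have hadd : ∀ t, 0 < t →
      C.K t (f - C.emb₀ (y₀ - x₀)) ≤ C.K t (C.emb₀ x₀) + C.K t (C.emb₁ y₁) := by
    intro t ht
    rw [hsub]
    exact C.K_add_le (C.emb₀_mem_sum _) (C.emb₁_mem_sum _) ht.le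
  refine ⟨C.emb₀ (y₀ - x₀), ⟨⟨_, rfl⟩, ⟨x₁ - y₁, ?_⟩⟩, fun t ht hta => ?_, fun t htb => ?_,
    fun t ht => ?_⟩
  · change C.emb₁ (x₁ - y₁) = C.emb₀ (y₀ - x₀)
    rw [map_sub, map_sub, sub_eq_sub_iff_add_eq_add, add_comm, hx, hy]
  · have h1 : C.K t (C.emb₀ x₀) ≤ C.K t f + t * ‖x₁‖ := by
      have : C.emb₀ x₀ = f + C.emb₁ (-x₁) := by rw [← hx, map_neg]; abel
      rw [this]
      refine (C.K_add_le hf (C.emb₁_mem_sum _) ht.le).trans ?_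
      gcongr
      simpa using C.K_emb₁_le ht.le (-x₁)
    have h2 : t * ‖x₁‖ ≤ 2 * C.K t f := by
      have h3 := C.mul_K_le_mul_K hf ht hta
      have h4 := mul_le_mul_of_nonneg_left hx₁ ht.le
      refine le_of_mul_le_mul_left ?_ ha
      linarith
    have h3 : t * C.K b f / b ≤ C.K t f := by
      rw [div_le_iff₀' hb]
      exact C.mul_K_le_mul_K hf ht (hta.trans hab.le)
    linarith [hadd t ht, C.K_emb₁_le ht.le y₁, hy₁' t ht]
  · have ht : 0 < t := hb.trans_le htb
    have h1 : C.K t (C.emb₁ y₁) ≤ C.K t f + ‖y₀‖ := by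
      have : C.emb₁ y₁ = f + C.emb₀ (-y₀) := by rw [← hy, map_neg]; abel
      rw [this]
      refine (C.K_add_le hf (C.emb₀_mem_sum _) ht.le).trans ?_
      gcongr
      simpa using C.K_emb₀_le ht.le (-y₀)
    have h2 := C.K_mono hf hb.le htb
    have h3 := C.K_mono hf ha.le (hab.le.trans htb)
    linarith [hadd t ht, C.K_emb₀_le ht.le x₀]
  · linarith [hadd t ht, C.K_emb₀_le ht.le x₀, C.K_emb₁_le ht.le y₁, hy₁' t ht]

lemma inter_subset_interpSpace {θ : ℝ} (hθ₀ : 0 < θ) (hθ₁ : θ < 1) {q : ℝ → ℝ}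
    (hq : ∀ x, 1 ≤ q x) : (C.inter : Set Z) ⊆ C.interpSpace θ q := by
  rintro f ⟨⟨x, hx⟩, ⟨y, hy⟩⟩
  replace hx : C.emb₀ x = f := hx
  replace hy : C.emb₁ y = f := hy
  have hθ : 0 < 1 - θ := by linarith
  refine ⟨hx ▸ C.emb₀_mem_sum x, ?_⟩
  set M : ℝ := ‖x‖ + ‖y‖ + 1
  have hM : 0 < M := by positivity
  set r : ℝ := M * (1 + 2 / θ + 2 / (1 - θ)) with hrdef
  have hr : 0 < r := by positivity
  have hle : ∀ z, 0 ≤ z → z ≤ M →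
      z / r ≤ 1 ∧ z / r / θ ≤ 1 / 2 ∧ z / r / (1 - θ) ≤ 1 / 2 := by
    intro z hz hzM
    have e1 : M * (2 / θ) ≤ r := by
      rw [hrdef]; gcongr; have : 0 < 2 / (1 - θ) := by positivity
      linarith
    have e2 : M * (2 / (1 - θ)) ≤ r := by
      rw [hrdef]; gcongr; have : 0 < 2 / θ := by positivity
      linarith
    have e3 : M ≤ r := by
      have : 0 < M * (2 / θ) := by positivity
      have : 0 < M * (2 / (1 - θ)) := by positivity
      rw [hrdef]; linarith
    refine ⟨(div_le_one hr).2 (hzM.trans e3), ?_, ?_⟩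
    · rw [div_div, div_le_iff₀ (by positivity)]
      rw [mul_div_assoc', div_le_iff₀ hθ₀] at e1
      linarith
    · rw [div_div, div_le_iff₀ (by positivity)]
      rw [mul_div_assoc', div_le_iff₀ hθ] at e2
      linarith
  obtain ⟨hx1, hx2, -⟩ := hle ‖x‖ (norm_nonneg _) (by simp only [M]; linarith [norm_nonneg y])
  obtain ⟨hy1, -, hy2⟩ := hle ‖y‖ (norm_nonneg _) (by simp only [M]; linarith [norm_nonneg x])
  have hnn : ∀ t, 0 < t → 0 ≤ t ^ (-θ) * C.K t f / r := fun t ht => by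
    have := C.K_nonneg ht.le f
    positivity
  refine (luxemburgNorm_le hr ?_).trans_lt ENNReal.ofReal_lt_top
  have hinf := setLIntegral_Ioi_rpow_exponent_le (h := fun t => t ^ (-θ) * C.K t f / r) hq hθ₀
    one_pos (by positivity) hx1 (fun t ht => hnn t (one_pos.trans ht)) (fun t ht => by
      have ht0 : 0 < t := one_pos.trans ht
      have := hx ▸ C.K_emb₀_le ht0.le x
      rw [div_one, div_mul_eq_mul_div, mul_comm]
      gcongr)
  have hzero := setLIntegral_Ioc_rpow_exponent_le (h := fun t => t ^ (-θ) * C.K t f / r) hq hθ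
    one_pos (by positivity) hy1 (fun t ht _ => hnn t ht) (fun t ht _ => by
      have := hy ▸ C.K_emb₁_le ht.le y
      rw [div_one, div_mul_eq_mul_div, sub_eq_neg_add, Real.rpow_add_one ht.ne']
      refine div_le_div_of_nonneg_right ?_ hr.le
      calc t ^ (-θ) * C.K t f ≤ t ^ (-θ) * (t * ‖y‖) := by gcongr
        _ = ‖y‖ * (t ^ (-θ) * t) := by ring)
  rw [modular, ← lintegral_add_compl _ measurableSet_Ioi,
    setLIntegral_measure_zero _ _ dtOverT_compl_Ioi, add_zero,
    ← Ioc_union_Ioi_eq_Ioi (zero_le_one' ℝ)]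
  refine (lintegral_union_le _ _ _).trans ((add_le_add hzero hinf).trans ?_)
  rw [← ENNReal.ofReal_add (by positivity) (by positivity)]
  exact ENNReal.ofReal_le_one.2 (by linarith)

lemma exists_mem_inter_interpNorm_sub_le {θ : ℝ} (hθ₀ : 0 < θ)
    (hθ₁ : θ < 1) {q : ℝ → ℝ} (hq : ∀ x, 1 ≤ q x) {Q : ℝ} (hQ : ∀ x, q x ≤ Q) {f : Z}
    (hf : f ∈ C.interpSpace θ q) {ε : ℝ} (hε : 0 < ε) :
    ∃ g ∈ C.inter, C.interpNorm θ q (f - g) ≤ ENNReal.ofReal ε := by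
  obtain ⟨hfs, hfn⟩ := hf
  have hθ : 0 < 1 - θ := by linarith
  obtain ⟨r, hr, hm⟩ := exists_modular_le_one hfn
  set P : ℝ → ℝ := fun t => t ^ (-θ) * C.K t f with hP
  have hP0 : ∀ t, 0 < t → 0 ≤ P t := fun t ht =>
    mul_nonneg (Real.rpow_nonneg ht.le _) (C.K_nonneg ht.le f)
  have hfin : ∀ c : ℝ, modular dtOverT q (fun t => c * P t) ≠ ∞ := by
    intro c
    convert modular_const_mul_ne_top hQ hq (ne_top_of_le_ne_top ENNReal.one_ne_top hm) (c * r)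
      using 3
    simp only [hP]
    field_simp
  have hfinP : modular dtOverT q P ≠ ∞ := by simpa using hfin 1
  set F : ℝ → ℝ≥0∞ := fun t => ‖5 / ε * P t‖ₑ ^ q t
  obtain ⟨a₀, ha₀, ha₀1, hFa⟩ := exists_setLIntegral_Ioc_le (hfin (5 / ε))
    (δ := ENNReal.ofReal (1 / 4)) (by simp)
  obtain ⟨b₀, hb₀1, hFb⟩ := exists_setLIntegral_Ici_le (hfin (5 / ε))
    (δ := ENNReal.ofReal (1 / 4)) (by simp)
  set η : ℝ := ε * (θ * (1 - θ)) / 8 with hη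
  have hη0 : 0 < η := by positivity
  obtain ⟨a, ⟨ha, haa₀⟩, hPa⟩ := exists_lt_of_modular_ne_top hQ hq hfinP measurableSet_Ioo
    (dtOverT_Ioo_eq_top ha₀) hη0
  obtain ⟨b, hbb₀, hPb⟩ := exists_lt_of_modular_ne_top hQ hq hfinP measurableSet_Ioi
    (dtOverT_Ioi_eq_top (one_pos.trans_le hb₀1)) hη0
  rw [mem_Ioi] at hbb₀
  have hab : a < b := by linarith
  have hb : 0 < b := ha.trans hab
  replace hPa : P a ≤ η := (le_abs_self _).trans hPa.le
  replace hPb : P b ≤ η := (le_abs_self _).trans hPb.le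
  obtain ⟨g, hg, hg0, hg_inf, hgm⟩ := C.exists_mem_inter_K_sub_le hfs ha hab
  refine ⟨g, hg, luxemburgNorm_le hε ?_⟩
  set h : ℝ → ℝ := fun t => t ^ (-θ) * C.K t (f - g) / ε with hh
  have hnn : ∀ t, 0 < t → 0 ≤ h t := fun t ht => by
    have := C.K_nonneg ht.le (f - g)
    positivity
  have hbound : ∀ t, 0 < t → C.K t (f - g) ≤ 5 * C.K t f → ‖h t‖ₑ ^ q t ≤ F t := by
    intro t ht hK
    refine ENNReal.rpow_le_rpow ?_ (by linarith [hq t])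
    rw [Real.enorm_eq_ofReal (hnn t ht), Real.enorm_eq_ofReal (by have := hP0 t ht; positivity)]
    refine ENNReal.ofReal_le_ofReal ?_
    calc h t ≤ t ^ (-θ) * (5 * C.K t f) / ε := by simp only [hh]; gcongr
      _ = 5 / ε * P t := by simp only [hP]; ring
  have hmid : ∫⁻ t in Ioo a b, ‖h t‖ₑ ^ q t ∂dtOverT ≤
      ENNReal.ofReal (2 * P a / ε / θ) + ENNReal.ofReal (2 * P b / ε / (1 - θ)) := by
    have hsmall : ∀ c, P c ≤ η → 2 * P c / ε ≤ 1 / 2 := by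
      intro c hc
      rw [div_le_iff₀ hε]
      have : θ * (1 - θ) ≤ 1 := by nlinarith
      nlinarith
    refine setLIntegral_Ioo_rpow_exponent_le hq hθ₀ hθ ha hb ?_ (hsmall a hPa) ?_ (hsmall b hPb)
      (fun t ht => hnn t (ha.trans ht.1)) fun t ht => ?_
    · have := hP0 a ha
      positivity
    · have := hP0 b hb
      positivity
    · have ht0 : 0 < t := ha.trans ht.1
      calc h t ≤ t ^ (-θ) * (2 * C.K a f + 2 * (t * C.K b f / b)) / ε := by
            simp only [hh]
            gcongr
            exact hgm t ht0
        _ = _ := by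
            simp only [hP]
            rw [Real.div_rpow ht0.le ha.le, Real.div_rpow ht0.le hb.le, sub_eq_neg_add,
              Real.rpow_add_one ht0.ne', Real.rpow_add_one hb.ne']
            have h1 : a ^ (-θ) ≠ 0 := by positivity
            have h2 : b ^ (-θ) ≠ 0 := by positivity
            field_simp
  have hleft : ∫⁻ t in Ioc 0 a, ‖h t‖ₑ ^ q t ∂dtOverT ≤ ENNReal.ofReal (1 / 4) := by
    refine le_trans ?_ ((lintegral_mono_set (Ioc_subset_Ioc_right haa₀.le)).trans hFa)
    exact setLIntegral_mono' measurableSet_Ioc fun t ht => hbound t ht.1 (hg0 t ht.1 ht.2)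
  have hright : ∫⁻ t in Ici b, ‖h t‖ₑ ^ q t ∂dtOverT ≤ ENNReal.ofReal (1 / 4) := by
    refine le_trans ?_ ((lintegral_mono_set (Ici_subset_Ici.2 hbb₀.le)).trans hFb)
    exact setLIntegral_mono' measurableSet_Ici fun t ht =>
      hbound t (hb.trans_le ht) (hg_inf t ht)
  have hcover : Ioi (0 : ℝ) = Ioc 0 a ∪ (Ioo a b ∪ Ici b) := by
    rw [Ioo_union_Ici_eq_Ioi hab, Ioc_union_Ioi_eq_Ioi ha.le]
  have hma : 2 * P a / ε / θ ≤ 1 / 4 := by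
    rw [div_div, div_le_iff₀ (by positivity)]
    nlinarith [mul_pos hε hθ₀]
  have hmb : 2 * P b / ε / (1 - θ) ≤ 1 / 4 := by
    rw [div_div, div_le_iff₀ (by positivity)]
    nlinarith [mul_pos hε hθ]
  rw [modular, ← lintegral_add_compl _ measurableSet_Ioi,
    setLIntegral_measure_zero _ _ dtOverT_compl_Ioi, add_zero, hcover]
  calc ∫⁻ t in Ioc 0 a ∪ (Ioo a b ∪ Ici b), ‖h t‖ₑ ^ q t ∂dtOverT
      ≤ ENNReal.ofReal (1 / 4) + ((ENNReal.ofReal (1 / 4) + ENNReal.ofReal (1 / 4)) +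
          ENNReal.ofReal (1 / 4)) := by
        refine (lintegral_union_le _ _ _).trans (add_le_add hleft
          ((lintegral_union_le _ _ _).trans (add_le_add (hmid.trans ?_) hright)))
        gcongr
    _ = 1 := by
        rw [← ENNReal.ofReal_add (by norm_num) (by norm_num),
          ← ENNReal.ofReal_add (by norm_num) (by norm_num),
          ← ENNReal.ofReal_add (by norm_num) (by norm_num)]
        norm_num

end CompatibleCouple

end VarInterp

theorem mainTheorem8 {𝕜 A₀ A₁ Z : Type*} [RCLike 𝕜]
    [NormedAddCommGroup A₀] [NormedSpace 𝕜 A₀] [CompleteSpace A₀]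
    [NormedAddCommGroup A₁] [NormedSpace 𝕜 A₁] [CompleteSpace A₁]
    [AddCommGroup Z] [Module 𝕜 Z] [TopologicalSpace Z] [IsTopologicalAddGroup Z]
    [ContinuousSMul 𝕜 Z] [T2Space Z]
    (C : VarInterp.CompatibleCouple 𝕜 A₀ A₁ Z)
    (θ : ℝ) (hθ₀ : 0 < θ) (hθ₁ : θ < 1)
    (q : ℝ → ℝ) (hq : VarInterp.IsVariableExponent q)
    (hq₀ : VarInterp.LogHolderAtOrigin q) (hq_inf : VarInterp.LogHolderAtInfinity q) :
    (C.inter : Set Z) ⊆ C.interpSpace θ q ∧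
      ∀ f ∈ C.interpSpace θ q, ∀ ε : ℝ, 0 < ε →
        ∃ g ∈ C.inter, C.interpNorm θ q (f - g) < ENNReal.ofReal ε := by
  obtain ⟨Q, hQ⟩ := hq₀.exists_le
  refine ⟨C.inter_subset_interpSpace hθ₀ hθ₁ hq.one_le, fun f hf ε hε => ?_⟩
  obtain ⟨g, hg, hle⟩ :=
    C.exists_mem_inter_interpNorm_sub_le hθ₀ hθ₁ hq.one_le hQ hf (half_pos hε)
  exact ⟨g, hg, hle.trans_lt ((ENNReal.ofReal_lt_ofReal_iff hε).2 (half_lt_self hε))⟩
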